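/- Setting. Let $\mathcal I$ be the set of intervals $I=[s,t)\subset\mathbb R$ with $-\infty<s<t<\infty$, and $I+u=[s+u,t+u)$. A continuous Bernoulli system $(\mathcal A,\varphi,(\mathcal A_I)_{I\in\mathcal I})$ consists of a von Neumann algebra $\mathcal A$ with separable predual, a faithful normal tracial state $\varphi$ on $\mathcal A$, and (unital) von Neumann subalgebras $\mathcal A_I\subset\mathcal A$ such that $\mathcal A$ is generated by all $\mathcal A_I$ as a von Neumann algebra, $\mathcal A_I\subset\mathcal A_J$ whenever $I\subset J$, and $\varphi(ab)=\varphi(a)\varphi(b)$ for $a\in\mathcal A_I$, $b\in\mathcal A_J$ whenever $I\cap J=\emptyset$. Let $L^p(\mathcal A)$ be the completion of $\mathcal A$ in $\|x\|_p=\varphi(|x|^p)^{1/p}$, and $L^{\infty-}(\mathcal A)=\bigcap_{1\le p<\infty}L^p(\mathcal A)$, an algebra to which $\varphi$ extends. An additive flow is a family $(B_I)_{I\in\mathcal I}$ with $B_I\in L^{\infty-}(\mathcal A_I)$, such that $(s,t)\mapsto B_{[s,t)}\in L^p(\mathcal A)$ is jointly continuous for all $1\le p<\infty$, and $B_{[s,u)}=B_{[s,t)}+B_{[t,u)}$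 for all $s<t<u$. Put $B_t:=B_{[0,t)}$ for $t>0$ and $B_0:=0$. For $I,J\in\mathcal I$ write $I<J$ if $s<t$ for all $s\in I$, $t\in J$. The flow, or the quantum Lévy process $(B_t)_{t\ge0}$, is order invariant if for all $n$ and all $I_1,\dots,I_n\in\mathcal I$, any two of which are equal or disjoint, $$\varphi(B_{I_1}\cdots B_{I_n})=\varphi(B_{I_1+t_1}\cdots B_{I_n+t_n})$$ for all $t_1,\dots,t_n\in\mathbb R$ such that, for all $k,l$, $I_k=I_l$ implies $t_k=t_l$, and $I_k<I_l$ implies $I_k+t_k<I_l+t_l$. (Such a flow is stationary.) Two tuples $\mathbf i,\mathbf j:\{1,\dots,n\}\to\mathbb N$ are order equivalent if $i(k)\le i(l)\Leftrightarrow j(k)\le j(l)$ for all $k,l$. Let $\mathcal O(n)$ be the finite set of equivalence classes, and for $\sigma\in\mathcal O(n)$ let $|\sigma|$ be the number of elements of the range of any $\mathbf i\in\sigma$. Theorem. Let $(B_t)_{t\ge0}$ be an order invariant quantum Lévy process. Then there exist constants $c(\sigma)\in\mathbb C$, for all $n\in\mathbb N$ and $\sigma\in\mathcal O(n)$, such that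 for all $n\in\mathbb N$ and all $t\ge0$ $$\varphi(B_t^n)=\sum_{\sigma\in\mathcal O(n)}\frac{1}{|\sigma|!}\,c(\sigma)\,t^{|\sigma|}.$$ -/

import Mathlib

open scoped ComplexOrder

/-- A tracial state on a unital C⋆-algebra (positivity is expressed with the order of `ℂ`:
`0 ≤ z` means that `z` is real and nonnegative). Normality and faithfulness, which make sense on
a von Neumann algebra, are imposed separately in `ContinuousBernoulliSystem`. -/
structure TracialState (A : Type*) [CStarAlgebra A] where
  toFun : A →ₗ[ℂ] ℂ
  map_one : toFun 1 = 1
  nonneg : ∀ x : A, 0 ≤ toFun (star x * x)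
  trace : ∀ x y : A, toFun (x * y) = toFun (y * x)

theorem pow_mul_aux {A : Type*} [Monoid A] (x y : A) (n : ℕ) :
    (x * y) ^ (n + 1) = x * ((y * x) ^ n * y) := by
  induction n with
  | zero => simp
  | succ n ih => rw [pow_succ, ih, pow_succ]; simp only [mul_assoc]

namespace TracialState

variable {A : Type*} [CStarAlgebra A] (τ : TracialState A)

/-- The `p`-norm `‖x‖_p = φ(|x|^p)^{1/p}` with `|x| = (x⋆x)^{1/2}`; the operator
`|x|^p` is the continuous functional calculus of `s ↦ (√s)^p` at `x⋆x`. -/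
noncomputable def pNorm (p : ℝ) (x : A) : ℝ :=
  (τ.toFun (cfc (fun s : ℝ => (√s) ^ p) (star x * x))).re ^ (1 / p)

theorem map_star (x : A) : τ.toFun (star x) = star (τ.toFun x) := by
  have hre : ∀ y : A, (τ.toFun (star y * y)).im = 0 := fun y =>
    ((Complex.nonneg_iff.1 (τ.nonneg y)).2).symm
  have h1 := hre (1 + x)
  have h2 := hre (1 + Complex.I • x)
  have h3 := hre x
  have h4 := τ.map_one
  simp [add_mul, mul_add, h4, smul_smul, h3] at h1 h2
  apply Complex.ext
  · simp
    linarith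
  · simp
    linarith

theorem cauchy_schwarz (x y : A) :
    ‖τ.toFun (star x * y)‖ ^ 2 ≤ (τ.toFun (star x * x)).re * (τ.toFun (star y * y)).re := by
  let c : PreInnerProductSpace.Core ℂ A :=
    { inner := fun x y => τ.toFun (star x * y)
      conj_inner_symm := fun x y => by
        have := τ.map_star (star y * x)
        simp at this
        simp [this]
      re_inner_nonneg := fun x => (Complex.nonneg_iff.1 (τ.nonneg x)).1
      add_left := fun x y z => by simp [add_mul]
      smul_left := fun x y r => by simp }
  have h := @InnerProductSpace.Core.inner_mul_inner_self_le ℂ A _ _ _ c x y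
  have h' : ‖τ.toFun (star y * x)‖ = ‖τ.toFun (star x * y)‖ := by
    have := τ.map_star (star x * y)
    simp at this
    simp [this]
  change ‖τ.toFun (star x * y)‖ * ‖τ.toFun (star y * x)‖ ≤ _ at h
  rw [h', ← sq] at h
  exact h

/-- Auxiliary recursive formula for the norm `‖x‖_p` with `p = 2 ^ (j + 1)`, see `pNorm_two_pow`.
It only serves to prove that the `p`-norms define a ring topology. -/
noncomputable def dyad : ℕ → A → ℝ
  | 0, x => √(τ.toFun (star x * x)).re
  | j + 1, x => √(dyad j (star x * x))

theorem dyad_nonneg (j : ℕ) (x : A) : 0 ≤ τ.dyad j x := by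
  cases j <;> exact Real.sqrt_nonneg _

theorem dyad_succ_sq (j : ℕ) (x : A) : τ.dyad (j + 1) x ^ 2 = τ.dyad j (star x * x) :=
  Real.sq_sqrt (τ.dyad_nonneg _ _)

theorem dyad_zero_sq (x : A) : τ.dyad 0 x ^ 2 = (τ.toFun (star x * x)).re :=
  Real.sq_sqrt (Complex.nonneg_iff.1 (τ.nonneg x)).1

theorem dyad_pow (j : ℕ) (x : A) :
    τ.dyad j x ^ 2 ^ (j + 1) = (τ.toFun ((star x * x) ^ 2 ^ j)).re := by
  induction j generalizing x with
  | zero => simpa using τ.dyad_zero_sq x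
  | succ j ih =>
    rw [pow_succ' 2 (j + 1), pow_mul, dyad_succ_sq, ih, star_mul, star_star, ← sq, ← pow_mul,
      ← pow_succ']

theorem trace_pow (x y : A) (n : ℕ) : τ.toFun ((x * y) ^ n) = τ.toFun ((y * x) ^ n) := by
  cases n with
  | zero => simp
  | succ n =>
    have h : (x * y) ^ (n + 1) = x * ((y * x) ^ n * y) := by
      exact pow_mul_aux x y n
    rw [h, τ.trace, mul_assoc, ← pow_succ]

theorem dyad_star (j : ℕ) (x : A) : τ.dyad j (star x) = τ.dyad j x := by
  refine (pow_left_inj₀ (τ.dyad_nonneg _ _) (τ.dyad_nonneg _ _)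
    (n := 2 ^ (j + 1)) (by positivity)).1 ?_
  rw [dyad_pow, dyad_pow, star_star, trace_pow]

theorem norm_le_dyad_zero (x y : A) : ‖τ.toFun (x * y)‖ ≤ τ.dyad 0 x * τ.dyad 0 y := by
  have h := τ.cauchy_schwarz (star x) y
  rw [star_star, ← star_star (x * star x)] at h
  refine abs_le_of_sq_le_sq' ?_ (mul_nonneg (τ.dyad_nonneg _ _) (τ.dyad_nonneg _ _)) |>.2
  rw [mul_pow, ← τ.dyad_star 0 x, dyad_zero_sq, dyad_zero_sq, star_star]
  simpa using h

theorem dyad_mul_and (j : ℕ) :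
    (∀ x y : A, τ.dyad j (x * y) ≤ τ.dyad (j + 1) x * τ.dyad (j + 1) y) ∧
    ∀ x : A, ‖τ.toFun (x ^ 2 ^ (j + 1))‖ ≤ τ.dyad j x ^ 2 ^ (j + 1) := by
  induction j with
  | zero =>
    constructor
    · intro x y
      refine abs_le_of_sq_le_sq' ?_ (mul_nonneg (τ.dyad_nonneg _ _) (τ.dyad_nonneg _ _)) |>.2
      rw [dyad_zero_sq, mul_pow, dyad_succ_sq, ← τ.dyad_star 1 y, dyad_succ_sq, star_star]
      have h : τ.toFun (star (x * y) * (x * y)) = τ.toFun ((star x * x) * (y * star y)) := by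
        rw [star_mul, mul_assoc, τ.trace]
        simp only [mul_assoc]
      rw [h]
      exact (Complex.re_le_norm _).trans (τ.norm_le_dyad_zero _ _)
    · intro x
      have := τ.norm_le_dyad_zero x x
      simpa [sq] using this
  | succ j ih =>
    obtain ⟨ih1, ih2⟩ := ih
    constructor
    · intro x y
      refine (pow_le_pow_iff_left₀ (τ.dyad_nonneg _ _)
        (mul_nonneg (τ.dyad_nonneg _ _) (τ.dyad_nonneg _ _)) (n := 2 ^ (j + 2))
        (by positivity)).1 ?_
      rw [dyad_pow]
      have h : τ.toFun ((star (x * y) * (x * y)) ^ 2 ^ (j + 1)) =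
          τ.toFun (((star x * x) * (y * star y)) ^ 2 ^ (j + 1)) := by
        rw [star_mul, mul_assoc, trace_pow]
        simp only [mul_assoc]
      rw [h]
      refine (Complex.re_le_norm _).trans ((ih2 _).trans ?_)
      rw [pow_succ' 2 (j + 1), pow_mul, mul_pow, dyad_succ_sq, ← τ.dyad_star (j + 2) y,
        dyad_succ_sq, star_star]
      exact pow_le_pow_left₀ (τ.dyad_nonneg _ _) (ih1 _ _) _
    · intro x
      rw [pow_succ' 2 (j + 1), pow_mul, pow_mul]
      refine (ih2 _).trans (pow_le_pow_left₀ (τ.dyad_nonneg _ _) ?_ _)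
      rw [sq, sq]
      exact ih1 x x

theorem dyad_mul (j : ℕ) (x y : A) : τ.dyad j (x * y) ≤ τ.dyad (j + 1) x * τ.dyad (j + 1) y :=
  (τ.dyad_mul_and j).1 x y

theorem dyad_add (j : ℕ) (x y : A) : τ.dyad j (x + y) ≤ τ.dyad j x + τ.dyad j y := by
  induction j generalizing x y with
  | zero =>
    refine abs_le_of_sq_le_sq' ?_ (add_nonneg (τ.dyad_nonneg _ _) (τ.dyad_nonneg _ _)) |>.2
    have h1 := (Complex.re_le_norm _).trans (τ.norm_le_dyad_zero (star x) y)
    have h2 := (Complex.re_le_norm _).trans (τ.norm_le_dyad_zero (star y) x)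
    rw [dyad_star] at h1 h2
    rw [dyad_zero_sq, add_sq, dyad_zero_sq, dyad_zero_sq]
    simp only [star_add, add_mul, mul_add, map_add, Complex.add_re]
    linarith
  | succ j ih =>
    refine abs_le_of_sq_le_sq' ?_ (add_nonneg (τ.dyad_nonneg _ _) (τ.dyad_nonneg _ _)) |>.2
    have h1 := τ.dyad_mul j (star x) y
    have h2 := τ.dyad_mul j (star y) x
    rw [dyad_star] at h1 h2
    rw [dyad_succ_sq, add_sq, dyad_succ_sq, dyad_succ_sq]
    simp only [star_add, add_mul, mul_add]
    have h3 := ih (star x * x + star y * x) (star x * y + star y * y)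
    have h4 := ih (star x * x) (star y * x)
    have h5 := ih (star x * y) (star y * y)
    linarith

theorem re_cfc_nonneg (a : A) (f : ℝ → ℝ) (hf : Continuous f)
    (h0 : ∀ s ∈ spectrum ℝ a, 0 ≤ f s) : 0 ≤ (τ.toFun (cfc f a)).re := by
  have h : cfc f a = star (cfc (fun s => √(f s)) a) * cfc (fun s => √(f s)) a := by
    have hs : IsSelfAdjoint (cfc (fun s => √(f s)) a) := cfc_predicate _ _
    rw [hs.star_eq, ← cfc_mul (fun s => √(f s)) (fun s => √(f s)) a
      (by fun_prop) (by fun_prop)]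
    exact cfc_congr fun s hs => (Real.mul_self_sqrt (h0 s hs)).symm
  rw [h]
  exact (Complex.nonneg_iff.1 (τ.nonneg _)).1

theorem moment_nonneg (p : ℝ) (hp : 0 < p) (x : A) :
    0 ≤ (τ.toFun (cfc (fun s : ℝ => (√s) ^ p) (star x * x))).re :=
  τ.re_cfc_nonneg _ _
    (Real.continuous_sqrt.rpow_const fun _ => .inr hp.le) fun _ _ => by positivity

theorem pNorm_nonneg (p : ℝ) (hp : 0 < p) (x : A) : 0 ≤ τ.pNorm p x :=
  Real.rpow_nonneg (τ.moment_nonneg p hp x) _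

theorem pNorm_mono {p q : ℝ} (hp : 1 ≤ p) (hpq : p ≤ q) (x : A) :
    τ.pNorm p x ≤ τ.pNorm q x := by
  have hp0 : 0 < p := by linarith
  have hq0 : 0 < q := by linarith
  have hpc : Continuous fun s : ℝ => (√s) ^ p :=
    Real.continuous_sqrt.rpow_const fun _ => .inr hp0.le
  have hqc : Continuous fun s : ℝ => (√s) ^ q :=
    Real.continuous_sqrt.rpow_const fun _ => .inr hq0.le
  have hF := τ.moment_nonneg p hp0 x
  have hG := τ.moment_nonneg q hq0 x
  unfold pNorm
  set F := (τ.toFun (cfc (fun s : ℝ => (√s) ^ p) (star x * x))).re with hFdef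
  set G := (τ.toFun (cfc (fun s : ℝ => (√s) ^ q) (star x * x))).re with hGdef
  rcases hF.eq_or_lt with h0 | hFpos
  · rw [← h0, Real.zero_rpow (by positivity)]
    positivity
  have hr : 1 ≤ q / p := (one_le_div hp0).2 hpq
  have key : F ^ (q / p) ≤ G := by
    have hn := τ.re_cfc_nonneg (star x * x)
      (fun s => (√s) ^ q - (F ^ (q / p) * (q / p) / F * (√s) ^ p +
        (F ^ (q / p) - F ^ (q / p) * (q / p)))) (by fun_prop) (by
          intro s _
          have hu : (-1 : ℝ) ≤ (√s) ^ p / F - 1 := by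
            have : 0 ≤ (√s) ^ p / F := by positivity
            linarith
          have hb := one_add_mul_self_le_rpow_one_add hu hr
          have e1 : (1 + ((√s) ^ p / F - 1)) ^ (q / p) = (√s) ^ q / F ^ (q / p) := by
            rw [add_sub_cancel, Real.div_rpow (by positivity) hF,
              ← Real.rpow_mul (by positivity), mul_div_cancel₀ _ hp0.ne']
          rw [e1, le_div_iff₀ (by positivity)] at hb
          have e2 : (1 + q / p * ((√s) ^ p / F - 1)) * F ^ (q / p) =
            F ^ (q / p) * (q / p) / F * (√s) ^ p +
              (F ^ (q / p) - F ^ (q / p) * (q / p)) := by field_simp; ring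
          rw [e2] at hb
          linarith)
    rw [cfc_sub (fun s : ℝ => (√s) ^ q) _ (star x * x) hqc.continuousOn
        (by exact ((continuous_const.mul hpc).add continuous_const).continuousOn),
      cfc_add (star x * x) _ _ (by exact (continuous_const.mul hpc).continuousOn) (by fun_prop),
      cfc_const_mul _ (fun s : ℝ => (√s) ^ p) (star x * x) hpc.continuousOn,
      cfc_const _ (star x * x), Algebra.algebraMap_eq_smul_one,
      ← Complex.coe_smul, ← Complex.coe_smul] at hn
    simp only [map_sub, map_add, map_smul, τ.map_one, smul_eq_mul, Complex.sub_re,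
      Complex.add_re, Complex.re_ofReal_mul, ← hFdef, ← hGdef, mul_one, Complex.ofReal_re] at hn
    have e3 : F ^ (q / p) * (q / p) / F * F = F ^ (q / p) * (q / p) := by field_simp
    rw [e3] at hn
    linarith
  calc F ^ (1 / p) = (F ^ (q / p)) ^ (1 / q) := by
        rw [← Real.rpow_mul hF]; congr 1; field_simp
    _ ≤ G ^ (1 / q) := Real.rpow_le_rpow (by positivity) key (by positivity)

theorem pNorm_two_pow (j : ℕ) (x : A) : τ.pNorm (2 ^ (j + 1)) x = τ.dyad j x := by
  have hsa : IsSelfAdjoint (star x * x) := .star_mul_self x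
  have h : cfc (fun s : ℝ => (√s) ^ ((2 : ℝ) ^ (j + 1))) (star x * x) = (star x * x) ^ 2 ^ j := by
    rw [← cfc_pow_id (R := ℝ) (star x * x) (2 ^ j)]
    refine cfc_congr fun s hs => ?_
    have hs0 : 0 ≤ s := spectrum_star_mul_self_nonneg s hs
    have : ((2 : ℝ) ^ (j + 1)) = ((2 * 2 ^ j : ℕ) : ℝ) := by push_cast; ring
    simp only [this, Real.rpow_natCast, pow_mul, Real.sq_sqrt hs0]
  rw [pNorm, h, ← dyad_pow, one_div]
  have : ((2 : ℝ) ^ (j + 1)) = ((2 ^ (j + 1) : ℕ) : ℝ) := by push_cast; ring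
  rw [this, Real.pow_rpow_inv_natCast (τ.dyad_nonneg _ _) (by positivity)]

theorem exists_le_dyad (p : ℝ) (hp : 1 ≤ p) : ∃ j : ℕ, ∀ x : A, τ.pNorm p x ≤ τ.dyad j x := by
  obtain ⟨j, hj⟩ := pow_unbounded_of_one_lt p (one_lt_two)
  refine ⟨j, fun x => ?_⟩
  rw [← pNorm_two_pow]
  refine τ.pNorm_mono hp (hj.le.trans ?_) x
  exact pow_le_pow_right₀ one_le_two (Nat.le_succ j)

theorem dyad_one (j : ℕ) : τ.dyad j 1 = 1 := by
  induction j with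
  | zero => simp [dyad, τ.map_one]
  | succ j ih => simp [dyad, ih]

theorem dyad_zero' (j : ℕ) : τ.dyad j 0 = 0 := by
  induction j with
  | zero => simp [dyad]
  | succ j ih => simp [dyad, ih]

theorem dyad_neg (j : ℕ) (x : A) : τ.dyad j (-x) = τ.dyad j x := by
  cases j <;> simp [dyad]

theorem pNorm_zero (p : ℝ) (hp : 1 ≤ p) : τ.pNorm p 0 = 0 := by
  obtain ⟨j, hj⟩ := τ.exists_le_dyad p hp
  exact le_antisymm ((hj 0).trans (τ.dyad_zero' j).le) (τ.pNorm_nonneg p (by linarith) 0)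

/-- The balls `{x | ‖x‖_p < ε}` for all real `1 ≤ p < ∞` and `0 < ε`. -/
def pBalls : Set (Set A) :=
  {U | ∃ p : ℝ, 1 ≤ p ∧ ∃ ε : ℝ, 0 < ε ∧ U = {x | τ.pNorm p x < ε}}

theorem exists_dyad_subset {U : Set A} (hU : U ∈ τ.pBalls) :
    ∃ j : ℕ, ∃ ε : ℝ, 0 < ε ∧ {x | τ.dyad j x < ε} ⊆ U := by
  obtain ⟨p, hp, ε, hε, rfl⟩ := hU
  obtain ⟨j, hj⟩ := τ.exists_le_dyad p hp
  exact ⟨j, ε, hε, fun x hx => (hj x).trans_lt hx⟩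

theorem dyad_mem (j : ℕ) {ε : ℝ} (hε : 0 < ε) : {x | τ.dyad j x < ε} ∈ τ.pBalls :=
  ⟨2 ^ (j + 1), one_le_pow₀ one_le_two, ε, hε, by simp only [pNorm_two_pow]⟩

open scoped Pointwise in
/-- The balls of all the `p`-norms, `1 ≤ p < ∞`, are the basic neighbourhoods of `0` of a ring
topology. -/
@[reducible]
def ringFilterBasis : RingFilterBasis A where
  sets := τ.pBalls
  nonempty := ⟨_, τ.dyad_mem 0 one_pos⟩
  inter_sets := by
    rintro _ _ ⟨p, hp, ε, hε, rfl⟩ ⟨q, hq, δ, hδ, rfl⟩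
    refine ⟨_, ⟨max p q, hp.trans (le_max_left _ _), min ε δ, lt_min hε hδ, rfl⟩, ?_⟩
    intro x hx
    exact ⟨((τ.pNorm_mono hp (le_max_left _ _) x).trans_lt hx).trans_le (min_le_left _ _),
      ((τ.pNorm_mono hq (le_max_right _ _) x).trans_lt hx).trans_le (min_le_right _ _)⟩
  zero' := by
    rintro _ ⟨p, hp, ε, hε, rfl⟩
    simpa [τ.pNorm_zero p hp] using hε
  add' := by
    intro U hU
    obtain ⟨j, ε, hε, h⟩ := τ.exists_dyad_subset hU
    refine ⟨_, τ.dyad_mem j (half_pos hε), ?_⟩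
    rintro _ ⟨x, hx, y, hy, rfl⟩
    refine h ((τ.dyad_add j x y).trans_lt ?_)
    have hx' : τ.dyad j x < ε / 2 := hx
    have hy' : τ.dyad j y < ε / 2 := hy
    linarith
  neg' := by
    intro U hU
    obtain ⟨j, ε, hε, h⟩ := τ.exists_dyad_subset hU
    refine ⟨_, τ.dyad_mem j hε, fun x hx => h ?_⟩
    simpa [dyad_neg] using hx
  conj' := by
    intro x₀ U hU
    exact ⟨U, hU, fun x hx => by simpa using hx⟩
  mul' := by
    intro U hU
    obtain ⟨j, ε, hε, h⟩ := τ.exists_dyad_subset hU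
    refine ⟨_, τ.dyad_mem (j + 1) (lt_min hε one_pos), ?_⟩
    rintro _ ⟨x, hx, y, hy, rfl⟩
    refine h ((τ.dyad_mul j x y).trans_lt ?_)
    have hx' : τ.dyad (j + 1) x < ε := lt_of_lt_of_le hx (min_le_left _ _)
    have hy' : τ.dyad (j + 1) y < 1 := lt_of_lt_of_le hy (min_le_right _ _)
    have hx0 := τ.dyad_nonneg (j + 1) x
    nlinarith
  mul_left' := by
    intro x₀ U hU
    obtain ⟨j, ε, hε, h⟩ := τ.exists_dyad_subset hU
    have h0 := τ.dyad_nonneg (j + 1) x₀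
    refine ⟨_, τ.dyad_mem (j + 1) (ε := ε / (τ.dyad (j + 1) x₀ + 1)) (by positivity), ?_⟩
    intro x hx
    refine h ((τ.dyad_mul j x₀ x).trans_lt ?_)
    have hx' : τ.dyad (j + 1) x * (τ.dyad (j + 1) x₀ + 1) < ε :=
      (lt_div_iff₀ (by positivity)).1 hx
    have hx0 := τ.dyad_nonneg (j + 1) x
    nlinarith
  mul_right' := by
    intro x₀ U hU
    obtain ⟨j, ε, hε, h⟩ := τ.exists_dyad_subset hU
    have h0 := τ.dyad_nonneg (j + 1) x₀
    refine ⟨_, τ.dyad_mem (j + 1) (ε := ε / (τ.dyad (j + 1) x₀ + 1)) (by positivity), ?_⟩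
    intro x hx
    refine h ((τ.dyad_mul j x x₀).trans_lt ?_)
    have hx' : τ.dyad (j + 1) x * (τ.dyad (j + 1) x₀ + 1) < ε :=
      (lt_div_iff₀ (by positivity)).1 hx
    have hx0 := τ.dyad_nonneg (j + 1) x
    nlinarith

end TracialState

/-- The algebra `A` with the ring topology (and uniform structure) given by all the `p`-norms of
`τ`, `1 ≤ p < ∞`, instead of its operator norm. -/
def PreLInfMinus {A : Type*} [CStarAlgebra A] (_τ : TracialState A) : Type _ := A

namespace PreLInfMinus

variable {A : Type*} [CStarAlgebra A] (τ : TracialState A)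

noncomputable instance : Ring (PreLInfMinus τ) := inferInstanceAs (Ring A)

noncomputable instance : Algebra ℂ (PreLInfMinus τ) := inferInstanceAs (Algebra ℂ A)

noncomputable instance : UniformSpace (PreLInfMinus τ) :=
  letI : TopologicalSpace (PreLInfMinus τ) := τ.ringFilterBasis.topology
  haveI : IsTopologicalRing (PreLInfMinus τ) := τ.ringFilterBasis.isTopologicalRing
  IsTopologicalAddGroup.rightUniformSpace _

theorem nhds_zero_hasBasis :
    (nhds (0 : PreLInfMinus τ)).HasBasis (fun U : Set A => U ∈ τ.pBalls) id :=
  τ.ringFilterBasis.toAddGroupFilterBasis.nhds_zero_hasBasis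

instance : IsTopologicalRing (PreLInfMinus τ) := τ.ringFilterBasis.isTopologicalRing

instance : IsUniformAddGroup (PreLInfMinus τ) := 
  @isUniformAddGroup_of_addCommGroup (PreLInfMinus τ) _ τ.ringFilterBasis.topology
    (@IsTopologicalRing.to_topologicalAddGroup (PreLInfMinus τ) _ τ.ringFilterBasis.topology
      τ.ringFilterBasis.isTopologicalRing)

instance : UniformContinuousConstSMul ℂ (PreLInfMinus τ) where
  uniformContinuous_const_smul c := by
    refine uniformContinuous_addMonoidHom_of_continuous
      (f := DistribSMul.toAddMonoidHom (PreLInfMinus τ) c) ?_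
    have h : Continuous fun x : PreLInfMinus τ => algebraMap ℂ (PreLInfMinus τ) c * x :=
      continuous_const.mul continuous_id
    simpa only [← Algebra.smul_def] using! h

/-- The trace `τ` itself, on `A` with the topology of the `p`-norms. -/
noncomputable def trace : PreLInfMinus τ →ₗ[ℂ] ℂ := τ.toFun

theorem continuous_trace : Continuous (trace τ).toAddMonoidHom := by
  refine continuous_of_continuousAt_zero _ ?_
  rw [ContinuousAt, map_zero]
  refine ((nhds_zero_hasBasis τ).tendsto_iff
    Metric.nhds_basis_ball).2 fun ε hε => ?_
  refine ⟨_, τ.dyad_mem 0 hε, fun (x : A) hx => ?_⟩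
  have := τ.norm_le_dyad_zero x 1
  rw [mul_one, τ.dyad_one, mul_one] at this
  rw [mem_ball_zero_iff]
  exact this.trans_lt hx

end PreLInfMinus

/-- The algebra `L^{∞-}(A) = ⋂_{1 ≤ p < ∞} L^p(A)`, where `L^p(A)` is the completion of `A` in
`‖·‖_p`. As `‖·‖_p ≤ ‖·‖_q` for `p ≤ q`, the intersection is the projective limit of the
completions `L^q(A) → L^p(A)`, which is the completion of `A` for the family of all the norms
`‖·‖_p` together: given compatible `X_p ∈ L^p(A)`, elements `x_k ∈ A` with `‖x_k - X_k‖_k < 1/k`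
form a sequence that converges to `X_p` in every `L^p(A)`. The topology is the one of
simultaneous convergence in all `L^p(A)`, `1 ≤ p < ∞`, and the product is the
continuous extension of the product of `A` (a completion of a topological ring). -/
abbrev LInfMinus {A : Type*} [CStarAlgebra A] (τ : TracialState A) : Type _ :=
  UniformSpace.Completion (PreLInfMinus τ)

/-- The canonical ring homomorphism `A → L^{∞-}(A)`. -/
noncomputable def LInfMinus.of {A : Type*} [CStarAlgebra A] (τ : TracialState A) :
    A →+* LInfMinus τ :=
  UniformSpace.Completion.coeRingHom (α := PreLInfMinus τ)

/-- The extension of the trace to `L^{∞-}(A)` by continuity. -/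
noncomputable def LInfMinus.expect {A : Type*} [CStarAlgebra A] (τ : TracialState A) :
    LInfMinus τ →ₗ[ℂ] ℂ where
  __ := (PreLInfMinus.trace τ).toAddMonoidHom.extension (PreLInfMinus.continuous_trace τ)
  map_smul' c X := by
    have h0 : Continuous
        ((PreLInfMinus.trace τ).toAddMonoidHom.extension (PreLInfMinus.continuous_trace τ)) :=
      AddMonoidHom.continuous_extension _ _
    change (PreLInfMinus.trace τ).toAddMonoidHom.extension _ (c • X) =
      c * (PreLInfMinus.trace τ).toAddMonoidHom.extension _ X
    induction X using UniformSpace.Completion.induction_on with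
    | hp => exact isClosed_eq (h0.comp (continuous_const_smul c)) (continuous_const.mul h0)
    | ih x =>
      rw [← UniformSpace.Completion.coe_smul, AddMonoidHom.extension_coe,
        AddMonoidHom.extension_coe]
      exact (PreLInfMinus.trace τ).map_smul c x

theorem LInfMinus.continuous_expect {A : Type*} [CStarAlgebra A] (τ : TracialState A) :
    Continuous (LInfMinus.expect τ) :=
  AddMonoidHom.continuous_extension (PreLInfMinus.trace τ).toAddMonoidHom
    (PreLInfMinus.continuous_trace τ)

theorem LInfMinus.expect_of {A : Type*} [CStarAlgebra A] (τ : TracialState A) (x : A) :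
    LInfMinus.expect τ (LInfMinus.of τ x) = τ.toFun x :=
  AddMonoidHom.extension_coe (PreLInfMinus.trace τ).toAddMonoidHom
    (PreLInfMinus.continuous_trace τ) x

/-- The half-open intervals `[s, t)` with `s < t`, given by their end points, with the topology
of joint convergence of both end points. -/
abbrev HalfOpenInterval : Type := {p : ℝ × ℝ // p.1 < p.2}

namespace HalfOpenInterval

/-- The interval `[s, t)` as a set. -/
def toSet (I : HalfOpenInterval) : Set ℝ := Set.Ico I.1.1 I.1.2

/-- The translate `I + u`. -/
def shift (I : HalfOpenInterval) (u : ℝ) : HalfOpenInterval :=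
  ⟨(I.1.1 + u, I.1.2 + u), add_lt_add_left I.2 u⟩

/-- The relation `I < J`: every point of `I` is smaller than every point of `J`. -/
def Before (I J : HalfOpenInterval) : Prop := ∀ s ∈ I.toSet, ∀ t ∈ J.toSet, s < t

end HalfOpenInterval

section VonNeumann

variable {H : Type*} [NormedAddCommGroup H] [InnerProductSpace ℂ H] [CompleteSpace H]

/-- A von Neumann algebra is norm closed, hence a C⋆-algebra. -/
instance VonNeumannAlgebra.isClosed_toStarSubalgebra (M : VonNeumannAlgebra H) :
    IsClosed (M.toStarSubalgebra : Set (H →L[ℂ] H)) := by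
  rw [VonNeumannAlgebra.coe_toStarSubalgebra, ← M.centralizer_centralizer]
  exact Set.isClosed_centralizer _

/-- A linear functional on a von Neumann algebra is normal (that is, `σ`-weakly continuous) if it
has the form `x ↦ ∑ ⟨ξ_n, x η_n⟩` with `∑ ‖ξ_n‖² < ∞` and `∑ ‖η_n‖² < ∞`. -/
def VonNeumannAlgebra.IsNormal (M : VonNeumannAlgebra H) (f : M.toStarSubalgebra →ₗ[ℂ] ℂ) :
    Prop :=
  ∃ ξ η : ℕ → H, Summable (fun n => ‖ξ n‖ ^ 2) ∧ Summable (fun n => ‖η n‖ ^ 2) ∧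
    ∀ x : M.toStarSubalgebra, HasSum (fun n => inner ℂ (ξ n) ((x : H →L[ℂ] H) (η n))) (f x)

/-- The predual of `M`: the set of normal functionals inside the dual Banach space of `M`. -/
def VonNeumannAlgebra.predual (M : VonNeumannAlgebra H) : Set (M.toStarSubalgebra →L[ℂ] ℂ) :=
  {f | M.IsNormal f.toLinearMap}

variable (H) in
/-- A (non-commutative) continuous Bernoulli system, on von Neumann algebras acting on `H`. -/
structure ContinuousBernoulliSystem where
  /-- The von Neumann algebra `𝓐`. -/
  algebra : VonNeumannAlgebra H
  separable_predual : TopologicalSpace.IsSeparable algebra.predual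
  /-- The tracial state `φ`. -/
  state : TracialState algebra.toStarSubalgebra
  state_normal : algebra.IsNormal state.toFun
  state_faithful : ∀ x : algebra.toStarSubalgebra, state.toFun (star x * x) = 0 → x = 0
  /-- The filtration `𝓐_I`. -/
  filtration : HalfOpenInterval → VonNeumannAlgebra H
  filtration_le : ∀ I, filtration I ≤ algebra
  /-- Global minimality: `𝓐` is the smallest von Neumann algebra that contains all `𝓐_I`. -/
  minimal : ∀ M : VonNeumannAlgebra H, (∀ I, filtration I ≤ M) → algebra ≤ M
  isotone : ∀ I J : HalfOpenInterval, I.toSet ⊆ J.toSet → filtration I ≤ filtration J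
  /-- `ℂ`-independence. -/
  independent : ∀ I J : HalfOpenInterval, I.toSet ∩ J.toSet = ∅ →
    ∀ a b : algebra.toStarSubalgebra, (a : H →L[ℂ] H) ∈ filtration I →
      (b : H →L[ℂ] H) ∈ filtration J →
        state.toFun (a * b) = state.toFun a * state.toFun b

namespace ContinuousBernoulliSystem

/-- The algebra `L^{∞-}(𝓐)`. -/
abbrev L (S : ContinuousBernoulliSystem H) : Type _ := LInfMinus S.state

/-- The extension of `φ` to `L^{∞-}(𝓐)`. -/
noncomputable abbrev expect (S : ContinuousBernoulliSystem H) : S.L →ₗ[ℂ] ℂ :=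
  LInfMinus.expect S.state

/-- The subset `L^{∞-}(𝓐_I)` of `L^{∞-}(𝓐)`: the closure of `𝓐_I`. -/
def adapted (S : ContinuousBernoulliSystem H) (I : HalfOpenInterval) : Set S.L :=
  closure (LInfMinus.of S.state '' {x | (x : H →L[ℂ] H) ∈ S.filtration I})

end ContinuousBernoulliSystem

/-- An additive `L^{∞-}`-flow. -/
structure AdditiveFlow (S : ContinuousBernoulliSystem H) where
  /-- The family `I ↦ B_I`. -/
  toFun : HalfOpenInterval → S.L
  /-- Joint continuity of `(s, t) ↦ B_{[s, t)}` in all `L^p(𝓐)`, `1 ≤ p < ∞`: the topology of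
  `L^{∞-}(𝓐)` is that of convergence in all of them. -/
  continuous : Continuous toFun
  adapted : ∀ I, toFun I ∈ S.adapted I
  additive : ∀ (s t u : ℝ) (hst : s < t) (htu : t < u),
    toFun ⟨(s, u), hst.trans htu⟩ = toFun ⟨(s, t), hst⟩ + toFun ⟨(t, u), htu⟩

namespace AdditiveFlow

variable {S : ContinuousBernoulliSystem H}

/-- Order invariance of a flow: a mixed moment `φ(B_{I_1} ⋯ B_{I_n})`, in which any two of the
intervals are equal or disjoint, does not change when the intervals are shifted against each
other (equal intervals by the same amount) in such a way that their order is kept. -/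
def IsOrderInvariant (B : AdditiveFlow S) : Prop :=
  ∀ (n : ℕ) (I : Fin n → HalfOpenInterval),
    (∀ k l, I k = I l ∨ (I k).toSet ∩ (I l).toSet = ∅) →
    ∀ t : Fin n → ℝ, (∀ k l, I k = I l → t k = t l) →
      (∀ k l, (I k).Before (I l) → ((I k).shift (t k)).Before ((I l).shift (t l))) →
      S.expect (List.ofFn fun k => B.toFun (I k)).prod =
        S.expect (List.ofFn fun k => B.toFun ((I k).shift (t k))).prod

/-- The quantum Lévy process `B_t = B_{[0, t)}` for `t > 0` and `B_0 = 0`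
(and `0` for `t < 0`, which is not used). -/
noncomputable def process (B : AdditiveFlow S) (t : ℝ) : S.L :=
  if h : 0 < t then B.toFun ⟨(0, t), h⟩ else 0

end AdditiveFlow

end VonNeumann

/-- Order equivalence of `n`-tuples of natural numbers. -/
def orderSetoid (n : ℕ) : Setoid (Fin n → ℕ) where
  r i j := ∀ k l, i k ≤ i l ↔ j k ≤ j l
  iseqv :=
    { refl := fun _ _ _ => Iff.rfl
      symm := fun h k l => (h k l).symm
      trans := fun h h' k l => (h k l).trans (h' k l) }

/-- The set `O(n)` of classes of `n`-tuples under order equivalence. -/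
def OrderClass (n : ℕ) : Type := Quotient (orderSetoid n)

namespace OrderClass

theorem card_image_le {n : ℕ} {i j : Fin n → ℕ} (h : ∀ k l, i k ≤ i l ↔ j k ≤ j l) :
    (Finset.univ.image i).card ≤ (Finset.univ.image j).card := by
  have hf : i.FactorsThrough j := fun k l hkl =>
    le_antisymm ((h k l).2 hkl.le) ((h l k).2 hkl.ge)
  have h1 : Finset.univ.image i = (Finset.univ.image j).image (j.extend i 0) := by
    rw [Finset.image_image]
    congr 1
    funext k
    exact (hf.extend_apply 0 k).symm
  rw [h1]
  exact Finset.card_image_le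

/-- The number `|σ|` of elements in the range of any tuple in the class `σ`. -/
def size {n : ℕ} (σ : OrderClass n) : ℕ :=
  Quotient.lift (s := orderSetoid n) (fun i : Fin n → ℕ => (Finset.univ.image i).card)
    (fun _ _ h => le_antisymm (card_image_le h) (card_image_le fun k l => (h k l).symm)) σ

instance finite (n : ℕ) : Finite (OrderClass n) := by
  let f : OrderClass n → Fin n → Fin n → Prop :=
    Quotient.lift (s := orderSetoid n) (fun i k l => i k ≤ i l)
      (fun _ _ h => funext fun k => funext fun l => propext (h k l))
  refine Finite.of_injective f fun σ ρ => ?_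
  refine Quotient.inductionOn₂ (s₁ := orderSetoid n) (s₂ := orderSetoid n) σ ρ fun i j hij => ?_
  exact Quotient.sound (s := orderSetoid n) fun k l => (congrFun (congrFun hij k) l).to_iff

noncomputable instance fintype (n : ℕ) : Fintype (OrderClass n) := Fintype.ofFinite _

end OrderClass

/-! Fix a step `h` and let M_h(i) be the moment of the increments over the cells [i_k h, (i_k + 1)
h). By order invariance M_h(i) depends only on the order class of i (`gridMoment_eq`).

The heart of the proof is that M_x(i) = x^|i| R(x) for x > 0, with R a polynomial. Cutting each cell
of length Nh into N pieces writes M_{Nh}(i) as a sum of the moments M_h(N i + g) over g with values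
in {0, …, N - 1}. Such a term depends only on how g is ordered on each fibre of i, since comparisons
between different fibres are decided by i. The number of g with a given pattern is a product of
binomial coefficients, one for each value of i, hence a polynomial in N divisible by N^|i|
(`exists_polynomial_card_fibreOrder`). So M_x(i) is such a polynomial along the multiples of every
step, and continuity of the flow extends this to all x > 0 (`exists_polynomial_of_forall_step`).

Now cut [0, t) into N pieces: φ(B_t^n) is the sum over σ of (N choose |σ|) M_{t/N}(σ)
(`expect_process_pow`). As N → ∞, the binomial times N^{-|σ|} tends to 1/|σ|!, which leaves the
formula with c(σ) = R_σ(0). -/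

/-! ### Order equivalent families and their number. -/

/-- Two families in linear orders that are ordered in the same way. -/
def OrderEquivalent {X α β : Type*} [LE α] [LE β] (i : X → α) (j : X → β) : Prop :=
  ∀ k l, i k ≤ i l ↔ j k ≤ j l

namespace OrderEquivalent

variable {X α β γ : Type*} [LinearOrder α] [LinearOrder β] [LinearOrder γ]
  {i : X → α} {j : X → β} {m : X → γ}

theorem symm (h : OrderEquivalent i j) : OrderEquivalent j i := fun k l => (h k l).symm

theorem trans (h : OrderEquivalent i j) (h' : OrderEquivalent j m) : OrderEquivalent i m :=
  fun k l => (h k l).trans (h' k l)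

theorem lt_iff (h : OrderEquivalent i j) (k l : X) : i k < i l ↔ j k < j l := by
  rw [← not_le, ← not_le, h l k]

theorem eq_iff (h : OrderEquivalent i j) (k l : X) : i k = i l ↔ j k = j l := by
  rw [le_antisymm_iff, le_antisymm_iff, h k l, h l k]

/-- The order isomorphism between the ranges of two order equivalent families. -/
noncomputable def rangeIso (h : OrderEquivalent i j) : Set.range i ≃o Set.range j where
  toFun x := ⟨j x.2.choose, Set.mem_range_self _⟩
  invFun y := ⟨i y.2.choose, Set.mem_range_self _⟩
  left_inv x := Subtype.ext <| by
    rw [← x.2.choose_spec, h.eq_iff]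
    exact (Set.mem_range_self (f := j) x.2.choose).choose_spec.trans (by rfl)
  right_inv y := Subtype.ext <| by
    rw [← y.2.choose_spec, ← h.eq_iff]
    exact (Set.mem_range_self (f := i) y.2.choose).choose_spec.trans (by rfl)
  map_rel_iff' {x y} := by
    change j _ ≤ j _ ↔ (x : α) ≤ y
    rw [← h, x.2.choose_spec, y.2.choose_spec]

theorem rangeIso_apply (h : OrderEquivalent i j) (k : X) :
    (h.rangeIso ⟨i k, Set.mem_range_self k⟩ : β) = j k :=
  (h.eq_iff _ _).1 (Set.mem_range_self (f := i) k).choose_spec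

/-- Order equivalent families with the same finite range are equal. -/
theorem eq_of_range_eq [Finite X] {i j : X → α} (h : OrderEquivalent i j)
    (hr : Set.range i = Set.range j) : i = j := by
  have : Finite (Set.range i) := Set.finite_range i
  funext k
  -- An order isomorphism between finite linear orders is unique.
  have e : h.rangeIso = OrderIso.setCongr _ _ hr := Subsingleton.elim _ _
  rw [← h.rangeIso_apply k, e]
  rfl

end OrderEquivalent

open Classical in
/-- The number of families in `{0, …, N - 1}` that are order equivalent to a given one. -/
theorem card_orderEquivalent {X : Type*} [Fintype X] (i : X → ℕ) (N : ℕ) :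
    Fintype.card {g : X → Fin N // OrderEquivalent g i} =
      N.choose (Finset.univ.image i).card := by
  rw [Fintype.card_subtype]
  conv_rhs => rw [← Fintype.card_fin N, ← Finset.card_univ, ← Finset.card_powersetCard]
  -- Within its order type a family is determined by its range, and every subset with as many
  -- elements as the range of `i` occurs as a range.
  refine Finset.card_bij (fun g _ => Finset.univ.image g) ?_ ?_ ?_
  · intro g hg
    rw [Finset.mem_filter] at hg
    rw [Finset.mem_powersetCard]
    refine ⟨Finset.subset_univ _, ?_⟩
    have h := Nat.card_congr hg.2.rangeIso.toEquiv
    rw [Nat.card_coe_set_eq, Nat.card_coe_set_eq] at h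
    rw [← Set.ncard_coe_finset, ← Set.ncard_coe_finset]
    simpa using h
  · intro g hg g' hg' h
    rw [Finset.mem_filter] at hg hg'
    refine (hg.2.trans hg'.2.symm).eq_of_range_eq ?_
    have := congrArg (fun s : Finset (Fin N) => (s : Set (Fin N))) h
    simpa using this
  · intro s hs
    rw [Finset.mem_powersetCard] at hs
    let e : Finset.univ.image i ≃o s :=
      ((Finset.univ.image i).orderIsoOfFin rfl).symm.trans (s.orderIsoOfFin hs.2)
    have hi : ∀ k, i k ∈ Finset.univ.image i := fun k =>
      Finset.mem_image_of_mem i (Finset.mem_univ k)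
    refine ⟨fun k => (e ⟨i k, hi k⟩ : Fin N), ?_, ?_⟩
    · rw [Finset.mem_filter]
      refine ⟨Finset.mem_univ _, fun k l => ?_⟩
      rw [Subtype.coe_le_coe, e.le_iff_le, Subtype.mk_le_mk]
    · ext x
      rw [Finset.mem_image]
      constructor
      · rintro ⟨k, _, rfl⟩
        exact Subtype.coe_prop _
      · intro hx
        obtain ⟨k, _, hk⟩ := Finset.mem_image.1 (e.symm ⟨x, hx⟩).2
        refine ⟨k, Finset.mem_univ _, ?_⟩
        have : (⟨i k, hi k⟩ : Finset.univ.image i) = e.symm ⟨x, hx⟩ := Subtype.ext hk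
        rw [this, e.apply_symm_apply]

/-! ### Counting families with a prescribed order on each fibre. -/

/-- A family of functions on the fibres of `i`, each with a prescribed property, is the same as a
function whose restrictions to the fibres have these properties. -/
def piFibreSubtypeEquiv {X Y β : Type*} [DecidableEq Y] [Fintype X] (i : X → Y)
    (p : ∀ a : Y, ({k // i k = a} → β) → Prop) :
    {g : X → β // ∀ a ∈ Finset.univ.image i, p a fun k => g k} ≃
      ∀ a : Finset.univ.image i, {g : {k // i k = a} → β // p a g} where
  toFun g a := ⟨fun k => g.1 k, g.2 a a.2⟩
  invFun G :=
    ⟨fun k => (G ⟨i k, Finset.mem_image_of_mem i (Finset.mem_univ k)⟩).1 ⟨k, rfl⟩, by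
      intro a ha
      convert (G ⟨a, ha⟩).2 using 1
      funext ⟨k, hk⟩
      subst hk
      rfl⟩
  left_inv g := rfl
  right_inv G := by
    funext ⟨a, ha⟩
    apply Subtype.ext
    funext ⟨k, hk⟩
    change i k = a at hk
    subst hk
    rfl

open Polynomial in
-- The polynomial is X (X - 1) ⋯ (X - k + 1) / k!, whose first factor exists because `k` is
-- positive.
theorem exists_polynomial_choose (k : ℕ) (hk : 0 < k) :
    ∃ Q : ℂ[X], X ∣ Q ∧ ∀ N : ℕ, (N.choose k : ℂ) = Q.eval (N : ℂ) := by
  refine ⟨C ((k.factorial : ℂ)⁻¹) * descPochhammer ℂ k, ?_, fun N => ?_⟩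
  · obtain ⟨k, rfl⟩ := Nat.exists_eq_succ_of_ne_zero hk.ne'
    rw [Nat.succ_eq_add_one, descPochhammer_succ_left]
    exact (dvd_mul_right _ _).mul_left _
  · have h0 : (k.factorial : ℂ) ≠ 0 := by exact_mod_cast k.factorial_ne_zero
    rw [eval_mul, eval_C, descPochhammer_eval_eq_descFactorial, Nat.descFactorial_eq_factorial_mul_choose]
    push_cast
    field_simp

/-- The comparisons between the values of `g` on the fibres of `i`. -/
def fibreOrder {X : Type*} (i g : X → ℕ) (k l : X) : Prop := i k = i l ∧ g k ≤ g l

open Classical Polynomial in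
/-- The number of `g : X → {0, …, N - 1}` that are ordered in a given way on the fibres of `i` is
a polynomial in `N`, divisible by the `|i|`-th power of `N`. -/
theorem exists_polynomial_card_fibreOrder {X : Type*} [Fintype X] (i : X → ℕ)
    (κ : X → X → Prop) :
    ∃ Q : ℂ[X], Polynomial.X ^ (Finset.univ.image i).card ∣ Q ∧ ∀ N : ℕ,
      (Fintype.card {g : X → Fin N // fibreOrder i (fun k => (g k : ℕ)) = κ} : ℂ) =
        Q.eval (N : ℂ) := by
  by_cases hκ : ∃ g₀ : X → ℕ, fibreOrder i g₀ = κ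
  swap
  -- A pattern realised by no function at all is counted zero times for every `N`.
  · refine ⟨0, dvd_zero _, fun N => ?_⟩
    have : IsEmpty {g : X → Fin N // fibreOrder i (fun k => (g k : ℕ)) = κ} :=
      ⟨fun g => hκ ⟨_, g.2⟩⟩
    simp
  obtain ⟨g₀, rfl⟩ := hκ
  have hpos : ∀ a : Finset.univ.image i,
      0 < (Finset.univ.image fun k : {k // i k = a} => g₀ k).card := by
    rintro ⟨a, ha⟩
    obtain ⟨k, _, hk⟩ := Finset.mem_image.1 ha
    exact Finset.card_pos.2 ⟨_, Finset.mem_image_of_mem _ (Finset.mem_univ ⟨k, hk⟩)⟩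
  choose Q hQ hQe using fun a => exists_polynomial_choose _ (hpos a)
  refine ⟨∏ a, Q a, ?_, fun N => ?_⟩
  · have := Finset.prod_dvd_prod_of_dvd (fun _ : Finset.univ.image i => (Polynomial.X : ℂ[X])) Q
      (s := Finset.univ) fun a _ => hQ a
    simpa using this
  · rw [eval_prod]
    -- Prescribing the pattern means prescribing the order type on each fibre independently. The
    -- count is therefore a product of binomial coefficients, and each nonempty fibre contributes
    -- one factor X.
    have e : {g : X → Fin N // fibreOrder i (fun k => (g k : ℕ)) = fibreOrder i g₀} ≃
        {g : X → Fin N // ∀ a ∈ Finset.univ.image i,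
          OrderEquivalent (fun k : {k // i k = a} => g k) fun k : {k // i k = a} => g₀ k} := by
      refine Equiv.subtypeEquivRight fun g => ⟨fun h a _ k l => ?_, fun h => ?_⟩
      · have := congrFun (congrFun h k) l
        simpa [fibreOrder, k.2, l.2] using this
      · funext k l
        refine propext (and_congr_right fun hkl => ?_)
        exact h (i k) (Finset.mem_image_of_mem i (Finset.mem_univ k)) ⟨k, rfl⟩ ⟨l, hkl.symm⟩
    rw [Fintype.card_congr (e.trans (piFibreSubtypeEquiv i fun a g =>
      OrderEquivalent g fun k : {k // i k = a} => g₀ k)), Fintype.card_pi]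
    push_cast
    refine Finset.prod_congr rfl fun a _ => ?_
    rw [← hQe, ← card_orderEquivalent]
    congr!

/-- Since the remainders are smaller than the multiplier, the sums are compared lexicographically:
first by `i`, then by the remainder within a fibre. The multiplier itself plays no role, so
different subdivisions can be compared. -/
theorem orderEquivalent_mul_add {X : Type*} {i g g' : X → ℕ} {N K : ℕ} (hg : ∀ k, g k < N)
    (hg' : ∀ k, g' k < K) (h : fibreOrder i g = fibreOrder i g') :
    OrderEquivalent (fun k => N * i k + g k) fun k => K * i k + g' k := by
  have key : ∀ {M : ℕ} {f : X → ℕ}, (∀ k, f k < M) → ∀ k l,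
      M * i k + f k ≤ M * i l + f l ↔ i k < i l ∨ fibreOrder i f k l := by
    intro M f hf k l
    have hk := hf k
    have hl := hf l
    rcases lt_trichotomy (i k) (i l) with h | h | h
    · have := Nat.mul_le_mul_left M (Nat.succ_le_of_lt h)
      rw [Nat.mul_succ] at this
      simp only [h, true_or, iff_true]
      omega
    · simp [fibreOrder, h]
    · have := Nat.mul_le_mul_left M (Nat.succ_le_of_lt h)
      rw [Nat.mul_succ] at this
      simp only [fibreOrder, h.not_gt, h.ne', false_and, or_self, iff_false]
      omega
  intro k l
  rw [key hg, key hg', h]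

open Polynomial Filter Topology in
/-- If `F` is continuous on `(0, ∞)` and, for each step `h`, a polynomial divisible by `X ^ k`
on the multiples of `h`, then it is a polynomial divisible by `X ^ k`. -/
theorem exists_polynomial_of_forall_step {F : ℝ → ℂ} {k : ℕ}
    (hF : ContinuousOn F (Set.Ioi 0))
    (H : ∀ h : ℝ, 0 < h → ∃ Q : ℂ[X], X ^ k ∣ Q ∧
      ∀ N : ℕ, 0 < N → F (N * h) = Q.eval (N : ℂ)) :
    ∃ R : ℂ[X], ∀ x : ℝ, 0 < x → F x = (x : ℂ) ^ k * R.eval (x : ℂ) := by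
  obtain ⟨Q, ⟨R, hR⟩, hQ⟩ := H 1 one_pos
  have hrat : ∀ p q : ℕ, 0 < p → 0 < q → F (p / q) = Q.eval ((p / q : ℝ) : ℂ) := by
    intro p q hp hq
    have hq' : (0 : ℝ) < q := by exact_mod_cast hq
    have hqc : (q : ℂ) ≠ 0 := by exact_mod_cast hq.ne'
    obtain ⟨P, -, hP⟩ := H (1 / q) (by positivity)
    -- The polynomials for the steps 1/q and 1 both describe `F` at each positive integer N, reached
    -- as qN steps of length 1/q. Agreement at infinitely many points makes them equal after
    -- rescaling.
    have hPQ : P.comp (C (q : ℂ) * X) = Q := by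
      refine Polynomial.eq_of_infinite_eval_eq _ _ (Set.Infinite.mono ?_
        ((Set.infinite_range_of_injective (Nat.cast_injective (R := ℂ))).sdiff
          (Set.finite_singleton 0)))
      rintro _ ⟨⟨N, rfl⟩, hN⟩
      have hN : 0 < N := Nat.pos_of_ne_zero fun h => hN (by simp [h])
      have h1 := hP (q * N) (by positivity)
      have h2 := hQ N hN
      have h3 : ((q * N : ℕ) : ℝ) * (1 / q) = N * 1 := by push_cast; field_simp
      rw [h3, h2] at h1
      simp only [Set.mem_ofPred_eq, eval_comp, eval_mul, eval_C, eval_X]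
      rw [h1]
      push_cast
      rfl
    have := hP p hp
    rw [mul_one_div] at this
    rw [this, ← hPQ]
    simp only [eval_comp, eval_mul, eval_C, eval_X]
    congr 1
    push_cast
    field_simp
  refine ⟨R, fun x hx => ?_⟩
  -- Rounding up keeps the numerators positive, as `hrat` requires.
  have hlim : Tendsto (fun q : ℕ => ((⌈x * q⌉₊ : ℝ) / q)) atTop (𝓝 x) :=
    (tendsto_nat_ceil_mul_div_atTop hx.le).comp tendsto_natCast_atTop_atTop
  have h1 : Tendsto (fun q : ℕ => F ((⌈x * q⌉₊ : ℝ) / q)) atTop (𝓝 (F x)) :=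
    (hF.continuousAt (Ioi_mem_nhds hx)).tendsto.comp hlim
  have h2 : Tendsto (fun q : ℕ => Q.eval (((⌈x * q⌉₊ : ℝ) / q : ℝ) : ℂ)) atTop
      (𝓝 (Q.eval (x : ℂ))) :=
    ((Q.continuous.comp Complex.continuous_ofReal).tendsto x).comp hlim
  have h3 : F x = Q.eval (x : ℂ) := by
    refine tendsto_nhds_unique (h1.congr' ?_) h2
    filter_upwards [eventually_gt_atTop 0] with q hq
    have hq' : (0 : ℝ) < q := by exact_mod_cast hq
    exact hrat _ q (Nat.ceil_pos.2 (by positivity)) hq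
  rw [h3, hR, eval_mul, eval_pow, eval_X]

open Filter Topology Asymptotics in
-- The source of the factor 1/|σ|! in the final formula.
theorem tendsto_choose_mul_inv_pow (k : ℕ) :
    Tendsto (fun N : ℕ => (N.choose k : ℂ) * ((N : ℂ)⁻¹) ^ k) atTop
      (𝓝 (1 / (k.factorial : ℂ))) := by
  have h1 : Tendsto (fun N : ℕ => (N.choose k : ℝ) * ((N : ℝ)⁻¹) ^ k) atTop
      (𝓝 (1 / (k.factorial : ℝ))) := by
    have h2 := (isEquivalent_choose k).mul
      (IsEquivalent.refl (u := fun N : ℕ => ((N : ℝ)⁻¹) ^ k) (l := atTop))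
    refine h2.symm.tendsto_nhds (tendsto_const_nhds.congr' ?_)
    filter_upwards [eventually_gt_atTop 0] with N hN
    have : (N : ℝ) ≠ 0 := by exact_mod_cast hN.ne'
    simp only [Pi.mul_apply, inv_pow]
    field_simp
  have h3 := (Complex.continuous_ofReal.tendsto _).comp h1
  simpa [Function.comp_def] using h3

/-! ### Moments of increments over the cells of a grid. -/

namespace AdditiveFlow

variable {H : Type*} [NormedAddCommGroup H] [InnerProductSpace ℂ H] [CompleteSpace H]
  {S : ContinuousBernoulliSystem H} (B : AdditiveFlow S)

/-- `B_{[s, t)}` for `s < t`, and `0` otherwise. -/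
noncomputable def increment (s t : ℝ) : S.L :=
  if h : s < t then B.toFun ⟨(s, t), h⟩ else 0

theorem increment_of_lt {s t : ℝ} (h : s < t) : B.increment s t = B.toFun ⟨(s, t), h⟩ :=
  dif_pos h

theorem increment_self (s : ℝ) : B.increment s s = 0 :=
  dif_neg (lt_irrefl s)

theorem increment_add {s t u : ℝ} (hst : s ≤ t) (htu : t ≤ u) :
    B.increment s t + B.increment t u = B.increment s u := by
  rcases hst.eq_or_lt with rfl | hst
  · rw [increment_self, zero_add]
  rcases htu.eq_or_lt with rfl | htu
  · rw [increment_self, add_zero]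
  rw [increment_of_lt B hst, increment_of_lt B htu, increment_of_lt B (hst.trans htu),
    B.additive s t u hst htu]

theorem sum_increment (s : ℝ) {h : ℝ} (hh : 0 ≤ h) (N : ℕ) :
    ∑ g : Fin N, B.increment (s + g * h) (s + (g + 1) * h) = B.increment s (s + N * h) := by
  induction N with
  | zero => simp [increment_self]
  | succ N ih =>
    rw [Fin.sum_univ_castSucc]
    simp only [Fin.val_castSucc, Fin.val_last]
    rw [ih, increment_add]
    · push_cast; rfl
    · have : 0 ≤ N * h := by positivity
      linarith
    · linarith

theorem continuousOn_increment {a b : ℝ} (hab : a < b) :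
    ContinuousOn (fun h : ℝ => B.increment (a * h) (b * h)) (Set.Ioi 0) := by
  -- For positive `h` the end points are always in strict order, so the default value 0 never enters
  -- and the joint continuity of the flow applies.
  rw [continuousOn_iff_continuous_domRestrict]
  have hlt : ∀ h : Set.Ioi (0 : ℝ), a * h < b * h := fun h => mul_lt_mul_of_pos_right hab h.2
  have : Set.domRestrict (Set.Ioi 0) (fun h : ℝ => B.increment (a * h) (b * h)) =
      fun h : Set.Ioi (0 : ℝ) => B.toFun ⟨(a * h, b * h), hlt h⟩ :=
    funext fun h => B.increment_of_lt (hlt h)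
  rw [this]
  exact B.continuous.comp (Continuous.subtype_mk (by fun_prop) _)

/-- The mixed moment of increments over intervals `[i_k h, (i_k + 1) h)` of length `h`. -/
noncomputable def gridMoment (h : ℝ) {n : ℕ} (i : Fin n → ℕ) : ℂ :=
  -- Viewing the product as a continuous multilinear map yields both its continuity and its
  -- expansion over sums; linearity over ℤ is enough for the latter.
  S.expect (ContinuousMultilinearMap.mkPiAlgebraFin ℤ n S.L fun k =>
    B.increment (i k * h) ((i k + 1) * h))

theorem continuousOn_gridMoment {n : ℕ} (i : Fin n → ℕ) :
    ContinuousOn (fun h => B.gridMoment h i) (Set.Ioi 0) := by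
  refine (LInfMinus.continuous_expect S.state).comp_continuousOn ?_
  refine (ContinuousMultilinearMap.cont _).comp_continuousOn ?_
  exact continuousOn_pi.2 fun k => B.continuousOn_increment (lt_add_one _)

theorem gridMoment_zero (h : ℝ) (n : ℕ) :
    B.gridMoment h (0 : Fin n → ℕ) = S.expect (B.process h ^ n) := by
  -- Both carry the same default value 0.
  have : B.process h = B.increment 0 h := rfl
  simp [gridMoment, this, ContinuousMultilinearMap.mkPiAlgebraFin_apply, List.ofFn_const]

/-- Subdivision of each interval of the grid into `N` equal parts. -/
theorem gridMoment_mul {h : ℝ} (hh : 0 ≤ h) (N : ℕ) {n : ℕ} (i : Fin n → ℕ) :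
    B.gridMoment (N * h) i =
      ∑ g : Fin n → Fin N, B.gridMoment h fun k => N * i k + (g k : ℕ) := by
  have : ∀ k, B.increment (i k * (N * h)) ((i k + 1) * (N * h)) =
      ∑ g : Fin N, B.increment ((N * i k + g : ℕ) * h) (((N * i k + g : ℕ) + 1) * h) := by
    intro k
    have h1 := B.sum_increment (i k * (N * h)) hh N
    have h2 : i k * (N * h) + N * h = (i k + 1) * (N * h) := by ring
    rw [h2] at h1
    rw [← h1]
    refine Finset.sum_congr rfl fun g _ => ?_
    push_cast
    congr 1 <;> ring
  unfold gridMoment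
  simp only [this]
  rw [ContinuousMultilinearMap.map_sum, map_sum]

variable {B}

/-- Moving the k-th cell by (j_k - i_k) h takes one configuration to the other. Cells of one grid
are equal or disjoint, and order equivalence says exactly that these shifts respect equality and
order. -/
theorem IsOrderInvariant.gridMoment_eq (hB : B.IsOrderInvariant) {h : ℝ} (hh : 0 < h) {n : ℕ}
    {i j : Fin n → ℕ} (hij : OrderEquivalent i j) : B.gridMoment h i = B.gridMoment h j := by
  have hlt : ∀ m : ℕ, (m : ℝ) * h < (m + 1) * h := fun m =>
    mul_lt_mul_of_pos_right (lt_add_one _) hh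
  let I (m : ℕ) : HalfOpenInterval := ⟨(m * h, (m + 1) * h), hlt m⟩
  have hI : ∀ m : ℕ, B.increment (m * h) ((m + 1) * h) = B.toFun (I m) := fun m =>
    B.increment_of_lt (hlt m)
  have hmono : ∀ {a b : ℕ}, a < b → ((a : ℝ) + 1) * h ≤ b * h := fun hab =>
    mul_le_mul_of_nonneg_right (by exact_mod_cast hab) hh.le
  have hbefore : ∀ {a b : ℕ}, (I a).Before (I b) ↔ a < b := by
    intro a b
    constructor
    · intro hab
      have := hab (a * h) ⟨le_rfl, hlt a⟩ (b * h) ⟨le_rfl, hlt b⟩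
      exact_mod_cast lt_of_mul_lt_mul_right this hh.le
    · intro hab s hs t ht
      exact (hs.2.trans_le (hmono hab)).trans_le ht.1
  have hshift : ∀ a b : ℕ, (I a).shift ((b - a) * h) = I b := by
    intro a b
    apply Subtype.ext
    apply Prod.ext
    · change a * h + (b - a) * h = b * h
      ring
    · change (a + 1) * h + (b - a) * h = (b + 1) * h
      ring
  have hinj : ∀ {a b : ℕ}, I a = I b → a = b := by
    intro a b hab
    have : (a : ℝ) * h = b * h := congrArg (fun J : HalfOpenInterval => J.1.1) hab
    exact_mod_cast mul_right_cancel₀ hh.ne' this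
  have key := hB n (fun k => I (i k)) ?_ (fun k => ((j k : ℝ) - i k) * h) ?_ ?_
  · simp only [hshift] at key
    simpa only [gridMoment, ContinuousMultilinearMap.mkPiAlgebraFin_apply, hI] using key
  · have hdis : ∀ {a b : ℕ}, a < b → (I a).toSet ∩ (I b).toSet = ∅ := by
      intro a b hab
      ext x
      simp only [Set.mem_inter_iff, Set.mem_empty_iff_false, iff_false, not_and]
      intro ha hb
      exact absurd (hbefore.2 hab x ha x hb) (lt_irrefl x)
    intro k l
    rcases lt_trichotomy (i k) (i l) with hkl | hkl | hkl
    · exact Or.inr (hdis hkl)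
    · exact Or.inl (congrArg I hkl)
    · exact Or.inr (by rw [Set.inter_comm]; exact hdis hkl)
  · intro k l hkl
    have h1 := hinj hkl
    have h2 := (hij.eq_iff k l).1 h1
    simp only [h1, h2]
  · intro k l hkl
    rw [hshift, hshift, hbefore]
    exact (hij.lt_iff k l).1 (hbefore.1 hkl)

open Classical Polynomial in
-- After subdivision the terms are grouped by their pattern on the fibres of `i`: each pattern
-- contributes a constant times the number of its realisations, which is a suitable polynomial in N.
theorem IsOrderInvariant.exists_polynomial_step (hB : B.IsOrderInvariant) {n : ℕ}
    (i : Fin n → ℕ) {h : ℝ} (hh : 0 < h) :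
    ∃ Q : ℂ[X], X ^ (Finset.univ.image i).card ∣ Q ∧
      ∀ N : ℕ, 0 < N → B.gridMoment (N * h) i = Q.eval (N : ℂ) := by
  -- The value has to be the same for all `N` at once, or it could not serve as a coefficient.
  -- Patterns that never occur get the arbitrary value 0.
  have hval : ∀ κ : Fin n → Fin n → Prop, ∃ v : ℂ, ∀ (N : ℕ) (g : Fin n → Fin N),
      fibreOrder i (fun k => (g k : ℕ)) = κ →
        B.gridMoment h (fun k => N * i k + (g k : ℕ)) = v := by
    intro κ
    by_cases hκ : ∃ (K : ℕ) (g' : Fin n → Fin K), fibreOrder i (fun k => (g' k : ℕ)) = κ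
    · obtain ⟨K, g', rfl⟩ := hκ
      exact ⟨_, fun N g hg => hB.gridMoment_eq hh
        (orderEquivalent_mul_add (fun k => (g k).2) (fun k => (g' k).2) hg)⟩
    · exact ⟨0, fun N g hg => (hκ ⟨N, g, hg⟩).elim⟩
  choose v hv using hval
  choose Q hQ hQe using exists_polynomial_card_fibreOrder i
  refine ⟨∑ κ, Q κ * C (v κ), Finset.dvd_sum fun κ _ => (hQ κ).mul_right _, fun N _ => ?_⟩
  rw [B.gridMoment_mul hh.le, eval_finsetSum,
    ← Finset.sum_fiberwise Finset.univ fun g : Fin n → Fin N => fibreOrder i fun k => (g k : ℕ)]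
  refine Finset.sum_congr rfl fun κ _ => ?_
  rw [Finset.sum_congr rfl fun g hg => hv κ N g (Finset.mem_filter.1 hg).2, Finset.sum_const,
    eval_mul, eval_C, ← hQe, Fintype.card_subtype, nsmul_eq_mul]

/-- The moment of increments over intervals of length `x` that are ordered like `i` is a
polynomial in `x` without terms of degree less than `|i|`. -/
theorem IsOrderInvariant.exists_polynomial (hB : B.IsOrderInvariant) {n : ℕ} (i : Fin n → ℕ) :
    ∃ R : Polynomial ℂ, ∀ x : ℝ, 0 < x →
      B.gridMoment x i = (x : ℂ) ^ (Finset.univ.image i).card * R.eval (x : ℂ) :=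
  exists_polynomial_of_forall_step (B.continuousOn_gridMoment i) fun _ hh =>
    hB.exists_polynomial_step i hh

end AdditiveFlow

/-! ### Summation over order classes and the limit of fine subdivisions. -/

namespace OrderClass

/-- The class of a tuple. -/
def mk {n : ℕ} (i : Fin n → ℕ) : OrderClass n := Quotient.mk (orderSetoid n) i

/-- A tuple in a given class. -/
noncomputable def rep {n : ℕ} (σ : OrderClass n) : Fin n → ℕ := Quotient.out (s := orderSetoid n) σ

theorem mk_rep {n : ℕ} (σ : OrderClass n) : mk σ.rep = σ := Quotient.out_eq (s := orderSetoid n) σ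

theorem mk_eq_iff {n : ℕ} {i : Fin n → ℕ} {σ : OrderClass n} :
    mk i = σ ↔ OrderEquivalent i σ.rep := by
  conv_lhs => rw [← mk_rep σ]
  exact Quotient.eq (r := orderSetoid n)

theorem size_eq {n : ℕ} (σ : OrderClass n) : (Finset.univ.image σ.rep).card = σ.size := by
  conv_rhs => rw [← mk_rep σ]
  rfl

theorem size_zero (σ : OrderClass 0) : σ.size = 0 := by
  rw [← size_eq, Finset.univ_eq_empty, Finset.image_empty, Finset.card_empty]

theorem size_pos {n : ℕ} (hn : n ≠ 0) (σ : OrderClass n) : 0 < σ.size := by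
  rw [← size_eq, Finset.card_pos]
  exact ⟨_, Finset.mem_image_of_mem _ (Finset.mem_univ ⟨0, Nat.pos_of_ne_zero hn⟩)⟩

end OrderClass

open Classical in
-- Expanding B_t as a sum of N increments gives one term for each tuple in {0, …, N - 1}; terms of
-- the same class are equal, and the class σ has (N choose |σ|) such tuples.
theorem AdditiveFlow.IsOrderInvariant.expect_process_pow {H : Type*} [NormedAddCommGroup H]
    [InnerProductSpace ℂ H] [CompleteSpace H] {S : ContinuousBernoulliSystem H}
    {B : AdditiveFlow S} (hB : B.IsOrderInvariant) (n : ℕ) {t : ℝ} (ht : 0 < t) {N : ℕ}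
    (hN : 0 < N) :
    S.expect (B.process t ^ n) =
      ∑ σ : OrderClass n, (N.choose σ.size : ℂ) * B.gridMoment (t / N) σ.rep := by
  have hN' : (0 : ℝ) < N := by exact_mod_cast hN
  have hh : 0 < t / N := by positivity
  have h1 := B.gridMoment_mul hh.le N (0 : Fin n → ℕ)
  rw [mul_div_cancel₀ _ hN'.ne', B.gridMoment_zero] at h1
  rw [h1, ← Finset.sum_fiberwise Finset.univ
    fun g : Fin n → Fin N => OrderClass.mk fun k => (g k : ℕ)]
  refine Finset.sum_congr rfl fun σ _ => ?_
  have h2 : ∀ g : Fin n → Fin N, OrderClass.mk (fun k => (g k : ℕ)) = σ →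
      B.gridMoment (t / N) (fun k => N * (0 : Fin n → ℕ) k + (g k : ℕ)) =
        B.gridMoment (t / N) σ.rep := by
    intro g hg
    simp only [Pi.zero_apply, mul_zero, zero_add]
    exact hB.gridMoment_eq hh (OrderClass.mk_eq_iff.1 hg)
  have h3 := card_orderEquivalent σ.rep N
  rw [OrderClass.size_eq, Fintype.card_subtype] at h3
  rw [Finset.sum_congr rfl fun g hg => h2 g (Finset.mem_filter.1 hg).2, Finset.sum_const,
    nsmul_eq_mul, ← h3]
  congr 3
  ext g
  simp only [Finset.mem_filter, Finset.mem_univ, true_and, OrderClass.mk_eq_iff]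
  rfl

open Filter Topology in
theorem mainTheorem1 {H : Type*} [NormedAddCommGroup H] [InnerProductSpace ℂ H] [CompleteSpace H]
    (S : ContinuousBernoulliSystem H) (B : AdditiveFlow S) (hB : B.IsOrderInvariant) :
    ∃ c : (n : ℕ) → OrderClass n → ℂ, ∀ (n : ℕ) (t : ℝ), 0 ≤ t →
      S.expect (B.process t ^ n) =
        ∑ σ : OrderClass n, 1 / (Nat.factorial σ.size : ℂ) * c n σ * (t : ℂ) ^ σ.size := by
  choose R hR using fun (n : ℕ) (i : Fin n → ℕ) => hB.exists_polynomial i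
  -- The constant c(σ) is the limit, as x → 0, of the moment of shape σ with cells of length x,
  -- divided by x^|σ|.
  refine ⟨fun n σ => (R n σ.rep).eval 0, fun n t ht => ?_⟩
  have hpos : ∀ (n : ℕ) {t : ℝ}, 0 < t → S.expect (B.process t ^ n) = ∑ σ : OrderClass n,
      1 / (Nat.factorial σ.size : ℂ) * (R n σ.rep).eval 0 * (t : ℂ) ^ σ.size := by
    clear ht t n
    intro n t ht
    have hstep : Tendsto (fun N : ℕ => ((t / N : ℝ) : ℂ)) atTop (𝓝 0) := by
      have := (Complex.continuous_ofReal.tendsto 0).comp (tendsto_const_div_atTop_nhds_zero_nat t)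
      rwa [Complex.ofReal_zero] at this
    have hlim : Tendsto (fun N : ℕ => ∑ σ : OrderClass n,
        (N.choose σ.size : ℂ) * ((N : ℂ)⁻¹) ^ σ.size *
          (R n σ.rep).eval ((t / N : ℝ) : ℂ) * (t : ℂ) ^ σ.size) atTop
        (𝓝 (∑ σ : OrderClass n,
          1 / (Nat.factorial σ.size : ℂ) * (R n σ.rep).eval 0 * (t : ℂ) ^ σ.size)) :=
      tendsto_finsetSum _ fun σ _ => ((tendsto_choose_mul_inv_pow σ.size).mul
        (((R n σ.rep).continuous.tendsto 0).comp hstep)).mul_const _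
    -- The moment of B_t equals the sum for every N > 0, so it equals the limit; the factor
    -- (t/N)^|σ| splits into N^{-|σ|}, absorbed by the binomial, and t^|σ|.
    refine tendsto_nhds_unique (tendsto_const_nhds.congr' ?_) hlim
    filter_upwards [eventually_gt_atTop 0] with N hN
    rw [hB.expect_process_pow n ht hN]
    refine Finset.sum_congr rfl fun σ _ => ?_
    rw [hR n σ.rep _ (by positivity), OrderClass.size_eq]
    push_cast
    ring
  rcases ht.eq_or_lt with rfl | ht
  -- At t = 0: for n = 0 every class has size 0, so the formula does not involve t and can be read
  -- off at t = 1; for n > 0 every class has positive size and both sides vanish.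
  · rcases eq_or_ne n 0 with rfl | hn
    · simpa [OrderClass.size_zero] using! hpos 0 one_pos
    · have h0 : B.process 0 = 0 := dif_neg (lt_irrefl 0)
      rw [h0, zero_pow hn, map_zero]
      refine (Finset.sum_eq_zero fun σ _ => ?_).symm
      rw [Complex.ofReal_zero, zero_pow (σ.size_pos hn).ne', mul_zero]
  · exact hpos n ht
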